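/- Let $d\ge 2$, and let $\mathcal K_d$ be the set of $d$-dimensional convex bodies, i.e. of convex compact subsets of $\mathbb R^d$ with non-empty interior, equipped with the Hausdorff distance. An affine invariant point on $\mathcal K_d$ is a map $p:\mathcal K_d\to\mathbb R^d$ that is continuous with respect to the Hausdorff distance and the Euclidean norm and satisfies $p(T(C))=T(p(C))$ for every $C\in\mathcal K_d$ and every invertible affine map $T:\mathbb R^d\to\mathbb R^d$. The set $\mathfrak P_d$ of all affine invariant points on $\mathcal K_d$ is an affine subspace of the real vector space $C(\mathcal K_d,\mathbb R^d)$ of continuous maps from $\mathcal K_d$ to $\mathbb R^d$. Theorem. The affine dimension of $\mathfrak P_d$ is infinite, i.e. the linear space of directions $\operatorname{span}\{p-q : p,q\in\mathfrak P_d\}$ is infinite-dimensional. -/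

import Mathlib

noncomputable section

/-- The set `𝒦_d` of `d`-dimensional convex bodies: convex compact subsets of Euclidean `ℝ^d` with
nonempty interior. -/
abbrev FullConvexBody (d : ℕ) : Type :=
  {K : ConvexBody (EuclideanSpace ℝ (Fin d)) //
    (interior (K : Set (EuclideanSpace ℝ (Fin d)))).Nonempty}

/-- The metric carried by `𝒦_d` is the Hausdorff distance of the underlying sets. -/
theorem FullConvexBody.dist_eq {d : ℕ} (C₁ C₂ : FullConvexBody d) :
    dist C₁ C₂ = Metric.hausdorffDist (C₁.1 : Set (EuclideanSpace ℝ (Fin d))) C₂.1 :=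
  rfl

/-- The image `T(C)` of a convex body under an invertible affine map. -/
def FullConvexBody.map {d : ℕ}
    (T : EuclideanSpace ℝ (Fin d) ≃ᵃ[ℝ] EuclideanSpace ℝ (Fin d)) (C : FullConvexBody d) :
    FullConvexBody d :=
  ⟨{ carrier := T '' C.1
     convex' := C.1.convex.affine_image T.toAffineMap
     isCompact' := C.1.isCompact.image T.toAffineMap.continuous_of_finiteDimensional
     nonempty' := C.1.nonempty.image T },
   by
    have h := (AffineEquiv.toContinuousAffineEquiv T).toHomeomorph.image_interior
      (C.1 : Set (EuclideanSpace ℝ (Fin d)))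
    have h2 := C.2.image T
    exact h ▸ h2⟩

theorem FullConvexBody.coe_map {d : ℕ}
    (T : EuclideanSpace ℝ (Fin d) ≃ᵃ[ℝ] EuclideanSpace ℝ (Fin d)) (C : FullConvexBody d) :
    ((FullConvexBody.map T C).1 : Set (EuclideanSpace ℝ (Fin d))) = T '' C.1 :=
  rfl

/-- The affine invariant points on `𝒦_d`, as an affine subspace of the real vector space
`C(𝒦_d, ℝ^d)` of maps that are continuous for the Hausdorff distance and the Euclidean norm. -/
def affineInvariantPoints (d : ℕ) :
    AffineSubspace ℝ C(FullConvexBody d, EuclideanSpace ℝ (Fin d)) where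
  carrier := {p | ∀ (T : EuclideanSpace ℝ (Fin d) ≃ᵃ[ℝ] EuclideanSpace ℝ (Fin d))
    (C : FullConvexBody d), p (FullConvexBody.map T C) = T (p C)}
  smul_vsub_vadd_mem' := by
    intro c p₁ p₂ p₃ h₁ h₂ h₃ T C
    have hT : T (c • (p₁ C - p₂ C) + p₃ C) = c • (T (p₁ C) - T (p₂ C)) + T (p₃ C) := by
      have e := T.toAffineMap.map_vadd (p₃ C) (c • (p₁ C - p₂ C))
      have e' := T.toAffineMap.linearMap_vsub (p₁ C) (p₂ C)
      simp only [vadd_eq_add, vsub_eq_sub, map_smul, AffineEquiv.coe_toAffineMap] at e e'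
      rw [e, e']
    simp only [vsub_eq_sub, vadd_eq_add, ContinuousMap.add_apply, ContinuousMap.smul_apply,
      ContinuousMap.sub_apply]
    rw [h₁ T C, h₂ T C, h₃ T C, hT]

end

/-! Affine invariant points can be varied by invariant scalars. If `v` is a difference of two such
points and `φ` is a continuous real function with `φ (T C) = φ C`, then `p + P(φ) v` is again an
affine invariant point for every polynomial `P`. If `φ` takes infinitely many values on the bodies
where `v` does not vanish, then `P ↦ P(φ) v` is injective, so the directions contain a copy of the
polynomial ring (`not_finiteDimensional_direction_affineInvariantPoints`).

Take `v C = centroid (2C - C) - centroid C` and `φ C = vol (2C - C) / vol C`. Prisms over trapezoids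
of parameter `c > 0` provide the values: there `φ = 3 ^ n (9 + 4 / (1 + 2c))`, which is injective in
`c`, and the first coordinates of the two centroids differ. -/

open MeasureTheory Filter Topology
open scoped Pointwise

/-! ### Continuity of integrals over convex bodies in the Hausdorff metric. -/

section ConvexBodyIntegral

variable {E : Type*} [NormedAddCommGroup E] [InnerProductSpace ℝ E]

theorem ConvexBody.exists_dist_lt {K L : ConvexBody E} {r : ℝ} (h : dist K L < r) {x : E}
    (hx : x ∈ K) : ∃ y ∈ L, dist x y < r :=
  Metric.exists_dist_lt_of_hausdorffDist_lt (t := (L : Set E)) hx h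
    ConvexBody.hausdorffEDist_ne_top

/-- A point deep inside a convex body belongs to every Hausdorff-close convex body. -/
theorem ConvexBody.mem_of_closedBall_subset [CompleteSpace E] {K L : ConvexBody E} {r : ℝ} {x : E}
    (hr : 0 ≤ r) (hx : Metric.closedBall x r ⊆ (K : Set E)) (h : dist K L < r) : x ∈ L := by
  by_contra hxL
  obtain ⟨f, u, hfu, hux⟩ := geometric_hahn_banach_closed_point L.convex L.isClosed hxL
  set w := (InnerProductSpace.toDual ℝ E).symm f with hw
  have hfw : ∀ y, f y = inner ℝ w y := fun y => by
    rw [hw, InnerProductSpace.toDual_symm_apply]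
  have hw0 : w ≠ 0 := by
    intro h0
    obtain ⟨y, hy⟩ := L.nonempty
    have h1 := hfu y hy
    rw [hfw, h0, inner_zero_left] at h1
    rw [hfw, h0, inner_zero_left] at hux
    linarith
  have hwn : 0 < ‖w‖ := norm_pos_iff.2 hw0
  -- Moving from `x` by `r` along the normal `w` of the separating hyperplane stays in `K` but ends
  -- at distance at least `r` from `L`.
  have hz : x + (r / ‖w‖) • w ∈ K := by
    apply hx
    rw [Metric.mem_closedBall, dist_eq_norm, add_sub_cancel_left, norm_smul, Real.norm_eq_abs,
      abs_of_nonneg (by positivity)]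
    field_simp
    exact le_refl _
  obtain ⟨y, hy, hxy⟩ := ConvexBody.exists_dist_lt h hz
  have h1 := hfu y hy
  have h2 := real_inner_le_norm w (x + (r / ‖w‖) • w - y)
  rw [← dist_eq_norm, inner_sub_right, inner_add_right, inner_smul_right,
    real_inner_self_eq_norm_sq, ← hfw, ← hfw] at h2
  have h3 : r / ‖w‖ * ‖w‖ ^ 2 = ‖w‖ * r := by field_simp
  have h4 := mul_lt_mul_of_pos_left hxy hwn
  linarith

variable [FiniteDimensional ℝ E] [MeasurableSpace E] [BorelSpace E]

/-- The integral of a continuous function over a convex body depends continuously on the body. -/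
theorem ConvexBody.continuous_setIntegral {G : Type*} [NormedAddCommGroup G] [NormedSpace ℝ G]
    (μ : Measure E) [μ.IsAddHaarMeasure] {f : E → G} (hf : Continuous f) :
    Continuous fun K : ConvexBody E => ∫ x in (K : Set E), f x ∂μ := by
  have hcomplete : CompleteSpace E := FiniteDimensional.complete ℝ E
  refine continuous_iff_continuousAt.2 fun K => ?_
  have hint : ∀ L : ConvexBody E, ∫ x in (L : Set E), f x ∂μ
      = ∫ x, (L : Set E).indicator f x ∂μ := fun L =>
    (integral_indicator L.isClosed.measurableSet).symm
  simp only [hint]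
  have hcpt : IsCompact (Metric.cthickening 1 (K : Set E)) := K.isCompact.cthickening
  refine continuousAt_of_dominated
    (bound := (Metric.cthickening 1 (K : Set E)).indicator fun x => ‖f x‖) ?_ ?_ ?_ ?_
  · exact .of_forall fun L =>
      (aestronglyMeasurable_indicator_iff L.isClosed.measurableSet).2
        (hf.continuousOn.integrableOn_compact L.isCompact).aestronglyMeasurable
  · filter_upwards [Metric.ball_mem_nhds K one_pos] with L hL
    refine .of_forall fun x => ?_
    rw [norm_indicator_eq_indicator_norm]
    refine Set.indicator_le_indicator_of_subset ?_ (fun _ => norm_nonneg _) x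
    intro y hy
    obtain ⟨z, hz, hyz⟩ := ConvexBody.exists_dist_lt (Metric.mem_ball.1 hL) hy
    exact Metric.mem_cthickening_of_dist_le y z 1 _ hz hyz.le
  · rw [integrable_indicator_iff hcpt.isClosed.measurableSet]
    exact hf.norm.continuousOn.integrableOn_compact hcpt
  -- Off the null boundary of `K`, membership of `x` is unchanged for all bodies close to `K`, so
  -- the indicators converge almost everywhere.
  · have hnull : ∀ᵐ x ∂μ, x ∉ frontier (K : Set E) :=
      measure_eq_zero_iff_ae_notMem.1 (K.convex.addHaar_frontier μ)
    filter_upwards [hnull] with x hx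
    by_cases hxK : x ∈ (K : Set E)
    · have hxi : x ∈ interior (K : Set E) := by
        by_contra h
        exact hx ⟨subset_closure hxK, h⟩
      obtain ⟨r, hr, hball⟩ := Metric.nhds_basis_closedBall.mem_iff.1
        (mem_interior_iff_mem_nhds.1 hxi)
      refine tendsto_nhds_of_eventually_eq ?_
      filter_upwards [Metric.ball_mem_nhds K hr] with L hL
      have hxL : x ∈ (L : Set E) :=
        ConvexBody.mem_of_closedBall_subset hr.le hball (by rw [dist_comm]; exact hL)
      simp [hxK, hxL]
    · obtain ⟨r, hr, hball⟩ := Metric.nhds_basis_closedBall.mem_iff.1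
        (K.isClosed.isOpen_compl.mem_nhds hxK)
      refine tendsto_nhds_of_eventually_eq ?_
      filter_upwards [Metric.ball_mem_nhds K hr] with L hL
      have hxL : x ∉ (L : Set E) := fun h => by
        obtain ⟨y, hy, hxy⟩ := ConvexBody.exists_dist_lt (Metric.mem_ball.1 hL) h
        exact hball (by rw [Metric.mem_closedBall, dist_comm]; exact hxy.le) hy
      simp [hxK, hxL]

end ConvexBodyIntegral

/-! ### Volume and centroid: continuity and behaviour under affine maps. -/

namespace FullConvexBody

variable {d : ℕ}

theorem measurableSet (C : FullConvexBody d) :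
    MeasurableSet (C.1 : Set (EuclideanSpace ℝ (Fin d))) :=
  C.1.isClosed.measurableSet

/-- The volume of a convex body. -/
noncomputable def vol (C : FullConvexBody d) : ℝ :=
  volume.real (C.1 : Set (EuclideanSpace ℝ (Fin d)))

/-- The centroid (barycentre) of a convex body. -/
noncomputable def centroid (C : FullConvexBody d) : EuclideanSpace ℝ (Fin d) :=
  (vol C)⁻¹ • ∫ x in (C.1 : Set (EuclideanSpace ℝ (Fin d))), x

theorem vol_pos (C : FullConvexBody d) : 0 < vol C :=
  ENNReal.toReal_pos (Measure.measure_pos_of_nonempty_interior volume C.2).ne' C.1.isCompact.measure_ne_top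

theorem vol_eq_integral (C : FullConvexBody d) :
    vol C = ∫ _ in (C.1 : Set (EuclideanSpace ℝ (Fin d))), (1 : ℝ) := by
  simp [vol]

theorem integrableOn (C : FullConvexBody d) {G : Type*} [NormedAddCommGroup G]
    {f : EuclideanSpace ℝ (Fin d) → G} (hf : Continuous f) :
    IntegrableOn f (C.1 : Set (EuclideanSpace ℝ (Fin d))) :=
  hf.continuousOn.integrableOn_compact C.1.isCompact

theorem continuous_vol : Continuous (vol : FullConvexBody d → ℝ) := by
  simp only [funext vol_eq_integral]
  exact (ConvexBody.continuous_setIntegral volume continuous_const).comp continuous_subtype_val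

theorem continuous_centroid :
    Continuous (centroid : FullConvexBody d → EuclideanSpace ℝ (Fin d)) :=
  (continuous_vol.inv₀ fun C => (vol_pos C).ne').smul
    ((ConvexBody.continuous_setIntegral volume continuous_id).comp continuous_subtype_val)

theorem setIntegral_map (T : EuclideanSpace ℝ (Fin d) ≃ᵃ[ℝ] EuclideanSpace ℝ (Fin d))
    (C : FullConvexBody d) {G : Type*} [NormedAddCommGroup G] [NormedSpace ℝ G]
    (g : EuclideanSpace ℝ (Fin d) → G) :
    ∫ x in ((map T C).1 : Set (EuclideanSpace ℝ (Fin d))), g x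
      = |LinearMap.det (T.linear : EuclideanSpace ℝ (Fin d) →ₗ[ℝ] EuclideanSpace ℝ (Fin d))| •
        ∫ x in (C.1 : Set (EuclideanSpace ℝ (Fin d))), g (T x) := by
  have hT : ∀ x, HasFDerivAt T
      (LinearMap.toContinuousLinearMap
        (T.linear : EuclideanSpace ℝ (Fin d) →ₗ[ℝ] EuclideanSpace ℝ (Fin d))) x := by
    intro x
    have h : (T : EuclideanSpace ℝ (Fin d) → EuclideanSpace ℝ (Fin d)) = fun y =>
        LinearMap.toContinuousLinearMap
          (T.linear : EuclideanSpace ℝ (Fin d) →ₗ[ℝ] EuclideanSpace ℝ (Fin d)) y + T 0 := by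
      funext y
      simpa using T.map_vadd 0 y
    rw [h]
    exact (ContinuousLinearMap.hasFDerivAt _).add_const _
  rw [coe_map, integral_image_eq_integral_abs_det_fderiv_smul volume C.measurableSet
    (fun x _ => (hT x).hasFDerivWithinAt) T.injective.injOn, integral_smul]
  rfl

theorem abs_det_linear_pos (T : EuclideanSpace ℝ (Fin d) ≃ᵃ[ℝ] EuclideanSpace ℝ (Fin d)) :
    0 < |LinearMap.det
      (T.linear : EuclideanSpace ℝ (Fin d) →ₗ[ℝ] EuclideanSpace ℝ (Fin d))| :=
  abs_pos.2 (LinearEquiv.isUnit_det' T.linear).ne_zero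

theorem vol_map (T : EuclideanSpace ℝ (Fin d) ≃ᵃ[ℝ] EuclideanSpace ℝ (Fin d))
    (C : FullConvexBody d) :
    vol (map T C) = |LinearMap.det
      (T.linear : EuclideanSpace ℝ (Fin d) →ₗ[ℝ] EuclideanSpace ℝ (Fin d))| * vol C := by
  rw [vol_eq_integral, vol_eq_integral, setIntegral_map, smul_eq_mul]

theorem centroid_map (T : EuclideanSpace ℝ (Fin d) ≃ᵃ[ℝ] EuclideanSpace ℝ (Fin d))
    (C : FullConvexBody d) : centroid (map T C) = T (centroid C) := by
  have hC := vol_pos C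
  have hD := abs_det_linear_pos T
  have hT : ∀ y, T y = LinearMap.toContinuousLinearMap
      (T.linear : EuclideanSpace ℝ (Fin d) →ₗ[ℝ] EuclideanSpace ℝ (Fin d)) y + T 0 := by
    intro y
    simpa using T.map_vadd 0 y
  have hI : ∫ x in (C.1 : Set (EuclideanSpace ℝ (Fin d))), T x
      = LinearMap.toContinuousLinearMap
        (T.linear : EuclideanSpace ℝ (Fin d) →ₗ[ℝ] EuclideanSpace ℝ (Fin d))
        (∫ x in (C.1 : Set (EuclideanSpace ℝ (Fin d))), x) + vol C • T 0 := by
    rw [← ContinuousLinearMap.integral_comp_comm (φ := fun x => x) _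
      (C.integrableOn continuous_id)]
    rw [integral_congr_ae (.of_forall hT), integral_add
      (C.integrableOn (ContinuousLinearMap.continuous _))
      (C.integrableOn continuous_const), setIntegral_const]
    rfl
  rw [centroid, setIntegral_map, vol_map, hI, hT (centroid C), centroid, map_smul, smul_smul,
    mul_inv_rev, mul_assoc, inv_mul_cancel₀ hD.ne', mul_one, smul_add, smul_smul,
    inv_mul_cancel₀ hC.ne', one_smul]

/-! ### The affine equivariant operation `C ↦ 2 C - C`. -/

/-- The convex body `2 C - C`. -/
def twoSub (C : FullConvexBody d) : FullConvexBody d :=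
  ⟨(2 : ℝ) • C.1 + (-1 : ℝ) • C.1, C.2.mono <| interior_mono fun x hx =>
    Set.mem_add.2 ⟨(2 : ℝ) • x, Set.smul_mem_smul_set hx, (-1 : ℝ) • x, Set.smul_mem_smul_set hx,
      by module⟩⟩

theorem mem_twoSub {C : FullConvexBody d} {x : EuclideanSpace ℝ (Fin d)} :
    x ∈ ((twoSub C).1 : Set (EuclideanSpace ℝ (Fin d))) ↔
      ∃ a ∈ C.1, ∃ b ∈ C.1, (2 : ℝ) • a - b = x := by
  rw [twoSub, ConvexBody.coe_add, ConvexBody.coe_smul, ConvexBody.coe_smul]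
  simp only [Set.mem_add, SetLike.mem_coe, Set.mem_smul_set]
  constructor
  · rintro ⟨_, ⟨a, ha, rfl⟩, _, ⟨b, hb, rfl⟩, rfl⟩
    exact ⟨a, ha, b, hb, by module⟩
  · rintro ⟨a, ha, b, hb, rfl⟩
    exact ⟨_, ⟨a, ha, rfl⟩, _, ⟨b, hb, rfl⟩, by module⟩

theorem continuous_twoSub : Continuous (twoSub : FullConvexBody d → FullConvexBody d) := by
  -- The constant is `|2| + |-1|`.
  refine (LipschitzWith.of_dist_le_mul (K := 3) fun C D => ?_).continuous
  have key : ∀ (C D : FullConvexBody d) (r : ℝ), dist C D < r →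
      ∀ x ∈ ((twoSub C).1 : Set (EuclideanSpace ℝ (Fin d))),
        ∃ y ∈ ((twoSub D).1 : Set (EuclideanSpace ℝ (Fin d))), dist x y ≤ 3 * r := by
    intro C D r hr x hx
    obtain ⟨a, ha, b, hb, rfl⟩ := mem_twoSub.1 hx
    obtain ⟨a', ha', haa⟩ := ConvexBody.exists_dist_lt (K := C.1) (L := D.1) hr ha
    obtain ⟨b', hb', hbb⟩ := ConvexBody.exists_dist_lt (K := C.1) (L := D.1) hr hb
    refine ⟨(2 : ℝ) • a' - b', mem_twoSub.2 ⟨a', ha', b', hb', rfl⟩, ?_⟩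
    refine (dist_sub_sub_le _ _ _ _).trans ?_
    rw [dist_smul₀, Real.norm_two]
    linarith
  refine le_of_forall_pos_le_add fun ε hε => ?_
  have h1 : dist C D < dist C D + ε / 3 := by linarith
  rw [dist_eq]
  refine Metric.hausdorffDist_le_of_mem_dist (by positivity) (fun x hx => ?_) fun x hx => ?_
  · obtain ⟨y, hy, h⟩ := key C D _ h1 x hx
    refine ⟨y, hy, h.trans (le_of_eq ?_)⟩
    push_cast
    ring
  · obtain ⟨y, hy, h⟩ := key D C _ (by rw [dist_comm]; exact h1) x hx
    refine ⟨y, hy, h.trans (le_of_eq ?_)⟩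
    push_cast
    ring

/-- The coefficients `2` and `-1` sum to `1`, so `2a - b` is an affine combination and `T` respects
it, translations included. -/
theorem twoSub_map (T : EuclideanSpace ℝ (Fin d) ≃ᵃ[ℝ] EuclideanSpace ℝ (Fin d))
    (C : FullConvexBody d) : twoSub (map T C) = map T (twoSub C) := by
  have hT : ∀ a b, T ((2 : ℝ) • a - b) = (2 : ℝ) • T a - T b := by
    intro a b
    have h := T.map_vadd a (a - b)
    have h' := T.toAffineMap.linearMap_vsub a b
    simp only [vadd_eq_add, vsub_eq_sub, AffineEquiv.linear_toAffineMap,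
      AffineEquiv.coe_toAffineMap, LinearEquiv.coe_coe] at h h'
    rw [show (2 : ℝ) • a - b = a - b + a by module, h, h']
    module
  refine Subtype.ext (SetLike.coe_injective (Set.ext fun x => ?_))
  rw [mem_twoSub, coe_map]
  constructor
  · rintro ⟨_, ⟨a, ha, rfl⟩, _, ⟨b, hb, rfl⟩, rfl⟩
    exact ⟨(2 : ℝ) • a - b, mem_twoSub.2 ⟨a, ha, b, hb, rfl⟩, hT a b⟩
  · rintro ⟨y, hy, rfl⟩
    obtain ⟨a, ha, b, hb, rfl⟩ := mem_twoSub.1 hy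
    exact ⟨T a, ⟨a, ha, rfl⟩, T b, ⟨b, hb, rfl⟩, (hT a b).symm⟩

end FullConvexBody

/-! ### From one direction and one invariant function to infinitely many directions. -/

/-- A subspace into which the polynomials embed is infinite-dimensional. -/
theorem Submodule.not_finiteDimensional_of_polynomial_mem {V : Type*} [AddCommGroup V] [Module ℝ V]
    {W : Submodule ℝ V} (F : Polynomial ℝ →ₗ[ℝ] V) (hF : ∀ P, F P ∈ W)
    (hker : ∀ P, F P = 0 → P = 0) : ¬ FiniteDimensional ℝ W := by
  intro hfin
  have hinj : Function.Injective (F.codRestrict W hF) := fun P Q hPQ =>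
    sub_eq_zero.1 (hker _ (by rw [map_sub, sub_eq_zero]; exact congrArg Subtype.val hPQ))
  exact Polynomial.not_finite (Module.Finite.of_injective _ hinj)

open FullConvexBody Polynomial in
/-- If `v` is a direction of the space of affine invariant points and `φ` an affine invariant
continuous function taking infinitely many values where `v` does not vanish, then the space of
directions has infinite dimension. -/
theorem not_finiteDimensional_direction_affineInvariantPoints {d : ℕ}
    {v : C(FullConvexBody d, EuclideanSpace ℝ (Fin d))}
    (hv : v ∈ (affineInvariantPoints d).direction) {φ : C(FullConvexBody d, ℝ)}
    (hφ : ∀ (T : EuclideanSpace ℝ (Fin d) ≃ᵃ[ℝ] EuclideanSpace ℝ (Fin d)) (C : FullConvexBody d),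
      φ (map T C) = φ C)
    {p : C(FullConvexBody d, EuclideanSpace ℝ (Fin d))} (hp : p ∈ affineInvariantPoints d)
    (hinf : (φ '' {C | v C ≠ 0}).Infinite) :
    ¬ FiniteDimensional ℝ (affineInvariantPoints d).direction := by
  intro hfin
  have hvT : ∀ (T : EuclideanSpace ℝ (Fin d) ≃ᵃ[ℝ] EuclideanSpace ℝ (Fin d))
      (C : FullConvexBody d), v (map T C) = T.linear (v C) := by
    intro T C
    have h := (AffineSubspace.vadd_mem_iff_mem_direction v hp).2 hv T C
    have h' := T.map_vadd (p C) (v C)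
    simp only [vadd_eq_add, ContinuousMap.add_apply] at h h'
    rw [h', hp T C] at h
    exact add_right_cancel h
  let F : ℝ[X] →ₗ[ℝ] C(FullConvexBody d, EuclideanSpace ℝ (Fin d)) :=
    { toFun := fun P => ⟨fun C => P.eval (φ C) • v C, by fun_prop⟩
      map_add' := fun P Q => by ext1 C; simp [add_smul]
      map_smul' := fun c P => by ext1 C; simp [mul_smul] }
  -- `p` serves as origin: the scalar `P (φ C)` is unchanged by `T` and commutes with its linear
  -- part.
  have hF : ∀ P, F P ∈ (affineInvariantPoints d).direction := by
    intro P
    rw [← AffineSubspace.vadd_mem_iff_mem_direction _ hp]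
    intro T C
    have h' := T.map_vadd (p C) (P.eval (φ C) • v C)
    simp only [vadd_eq_add] at h'
    change P.eval (φ (map T C)) • v (map T C) + p (map T C) = T (P.eval (φ C) • v C + p C)
    rw [h', hφ, hvT, hp T C, map_smul]
  have hker : ∀ P, F P = 0 → P = 0 := by
    intro P hP
    refine P.eq_zero_of_infinite_isRoot (hinf.mono ?_)
    rintro _ ⟨C, hC, rfl⟩
    exact (smul_eq_zero.1 (DFunLike.congr_fun hP C)).resolve_right hC
  exact Submodule.not_finiteDimensional_of_polynomial_mem F hF hker hfin

/-! ### Test bodies: prisms over trapezoids, and integration over them by slices. -/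

/-- Stated over a general space `X` to serve both Euclidean coordinates and the split product `ℝ × ℝ
× (Fin n → ℝ)`. -/
theorem isClosed_setOf_mem_Icc_and_abs_le {X ι : Type*} [TopologicalSpace X] {a b m : ℝ}
    {u v r : X → ℝ} {w : ι → X → ℝ} (hu : Continuous u) (hv : Continuous v) (hr : Continuous r)
    (hw : ∀ j, Continuous (w j)) :
    IsClosed {x | u x ∈ Set.Icc a b ∧ |v x| ≤ r x ∧ ∀ j, |w j x| ≤ m} := by
  have h : {x | u x ∈ Set.Icc a b ∧ |v x| ≤ r x ∧ ∀ j, |w j x| ≤ m}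
      = u ⁻¹' Set.Icc a b ∩ ({x | |v x| ≤ r x} ∩ ⋂ j, {x | |w j x| ≤ m}) := by
    ext x
    simp
  rw [h]
  exact (isClosed_Icc.preimage hu).inter <| (isClosed_le hv.abs hr).inter <|
    isClosed_iInter fun j => isClosed_le (hw j).abs continuous_const

/-- Splitting off the first two coordinates of a Euclidean space. -/
noncomputable def EuclideanSpace.splitTwo (n : ℕ) :
    EuclideanSpace ℝ (Fin (n + 2)) ≃ᵐ ℝ × ℝ × (Fin n → ℝ) :=
  (MeasurableEquiv.toLp 2 (Fin (n + 2) → ℝ)).symm.trans <|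
    (MeasurableEquiv.piFinSuccAbove (fun _ => ℝ) 0).trans <|
      (MeasurableEquiv.refl ℝ).prodCongr (MeasurableEquiv.piFinSuccAbove (fun _ => ℝ) 0)

theorem EuclideanSpace.measurePreserving_splitTwo (n : ℕ) :
    MeasurePreserving (EuclideanSpace.splitTwo n) volume volume :=
  ((MeasurePreserving.id volume).prod
    (volume_preserving_piFinSuccAbove (fun _ : Fin (n + 1) => ℝ) 0)).comp
    ((volume_preserving_piFinSuccAbove (fun _ : Fin (n + 2) => ℝ) 0).comp
      (PiLp.volume_preserving_ofLp (Fin (n + 2))))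

/-- The points with first coordinate `x ∈ [a, b]`, second coordinate at most `ρ x` in absolute value
and all other coordinates at most `m` in absolute value. -/
def profileSet (n : ℕ) (a b : ℝ) (ρ : ℝ → ℝ) (m : ℝ) : Set (EuclideanSpace ℝ (Fin (n + 2))) :=
  {z | z 0 ∈ Set.Icc a b ∧ |z 1| ≤ ρ (z 0) ∧ ∀ j : Fin n, |z j.succ.succ| ≤ m}

theorem setIntegral_profileSet {n : ℕ} {a b : ℝ} {ρ : ℝ → ℝ} {m : ℝ} (hab : a ≤ b)
    (hρ : Continuous ρ) (hρ0 : ∀ x ∈ Set.Icc a b, 0 ≤ ρ x) (hm : 0 ≤ m) {f : ℝ → ℝ}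
    (hf : IntegrableOn (fun z : EuclideanSpace ℝ (Fin (n + 2)) => f (z 0))
      (profileSet n a b ρ m)) :
    ∫ z in profileSet n a b ρ m, f (z 0) = (2 * m) ^ n * ∫ x in a..b, f x * (2 * ρ x) := by
  set S : Set (ℝ × ℝ × (Fin n → ℝ)) :=
    {p | p.1 ∈ Set.Icc a b ∧ |p.2.1| ≤ ρ p.1 ∧ ∀ j : Fin n, |p.2.2 j| ≤ m} with hS
  have hSm : MeasurableSet S := by
    exact (isClosed_setOf_mem_Icc_and_abs_le (by fun_prop) (by fun_prop) (by fun_prop)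
      fun j => by fun_prop).measurableSet
  have hpre : profileSet n a b ρ m = EuclideanSpace.splitTwo n ⁻¹' S := rfl
  have hmp := EuclideanSpace.measurePreserving_splitTwo n
  have hemb := (EuclideanSpace.splitTwo n).measurableEmbedding
  have hint : IntegrableOn (fun p : ℝ × ℝ × (Fin n → ℝ) => f p.1) S := by
    rw [hpre] at hf
    exact (hmp.integrableOn_comp_preimage hemb).1 hf
  have h1 : ∫ z in profileSet n a b ρ m, f (z 0) = ∫ p in S, f p.1 := by
    rw [hpre]
    exact hmp.setIntegral_preimage_emb hemb (fun p : ℝ × ℝ × (Fin n → ℝ) => f p.1) S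
  have hslice : ∀ x, ∫ q : ℝ × (Fin n → ℝ), S.indicator (fun p => f p.1) (x, q)
      = (Set.Icc a b).indicator (fun x => (2 * m) ^ n * (f x * (2 * ρ x))) x := by
    intro x
    by_cases hx : x ∈ Set.Icc a b
    -- The slice over `x` is a box of volume `2 ρ(x) (2m) ^ n`, on which the integrand is constant.
    · have hbox : (fun q : ℝ × (Fin n → ℝ) => S.indicator (fun p => f p.1) (x, q))
          = (Set.Icc (-ρ x) (ρ x) ×ˢ Set.Icc (fun _ : Fin n => -m) (fun _ => m)).indicator
            fun _ => f x := by
        funext q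
        have : (x, q) ∈ S ↔
            q ∈ Set.Icc (-ρ x) (ρ x) ×ˢ Set.Icc (fun _ : Fin n => -m) (fun _ => m) := by
          simp only [hS, Set.mem_ofPred_eq, Set.mem_prod, Set.mem_Icc, abs_le, Pi.le_def,
            forall_and, Set.mem_Icc.1 hx, and_self, true_and]
        by_cases hq : (x, q) ∈ S
        · rw [Set.indicator_of_mem hq, Set.indicator_of_mem (this.1 hq)]
        · rw [Set.indicator_of_notMem hq, Set.indicator_of_notMem (mt this.2 hq)]
      rw [hbox, integral_indicator (measurableSet_Icc.prod measurableSet_Icc), setIntegral_const,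
        Set.indicator_of_mem hx, Measure.volume_eq_prod, measureReal_prod_prod]
      have hv1 : volume.real (Set.Icc (-ρ x) (ρ x)) = 2 * ρ x := by
        rw [Real.volume_real_Icc_of_le (by linarith [hρ0 x hx])]
        ring
      have hv2 : volume.real (Set.Icc (fun _ : Fin n => -m) fun _ => m) = (2 * m) ^ n := by
        rw [measureReal_def, Real.volume_Icc_pi_toReal fun _ => by linarith]
        simp [two_mul]
      rw [hv1, hv2, smul_eq_mul]
      ring
    · have hz : ∀ q : ℝ × (Fin n → ℝ), S.indicator (fun p => f p.1) (x, q) = 0 := fun q =>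
        Set.indicator_of_notMem (fun h => hx h.1) _
      simp only [hz, integral_zero, Set.indicator_of_notMem hx]
  rw [h1, ← integral_indicator hSm, Measure.volume_eq_prod,
    integral_prod _ ((integrable_indicator_iff hSm).2 hint)]
  simp only [hslice]
  rw [integral_indicator measurableSet_Icc, integral_const_mul,
    intervalIntegral.integral_of_le hab, integral_Icc_eq_integral_Ioc]

/-- The prism over the trapezoid with vertices `(0, ± c)`, `(1, ± (1 + c))`. -/
def trapezoidPrism (n : ℕ) {c : ℝ} (hc : 0 < c) : FullConvexBody (n + 2) :=
  ⟨{ carrier := profileSet n 0 1 (fun x => x + c) 1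
     convex' := by
      rintro x ⟨⟨hx0, hx0'⟩, hx1, hx⟩ y ⟨⟨hy0, hy0'⟩, hy1, hy⟩ s t hs ht hst
      simp only [abs_le] at hx1 hy1 hx hy
      refine ⟨⟨?_, ?_⟩, abs_le.2 ⟨?_, ?_⟩, fun j => abs_le.2 ⟨?_, ?_⟩⟩ <;>
      simp only [PiLp.add_apply, PiLp.smul_apply, smul_eq_mul]
      · positivity
      · nlinarith
      · nlinarith
      · nlinarith
      · nlinarith [(hx j).1, (hy j).1]
      · nlinarith [(hx j).2, (hy j).2]
     isCompact' := by
      refine Metric.isCompact_of_isClosed_isBounded ?_ ?_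
      · exact isClosed_setOf_mem_Icc_and_abs_le (by fun_prop) (by fun_prop) (by fun_prop)
          fun j => by fun_prop
      · have hb : Bornology.IsBounded (WithLp.ofLp '' profileSet n 0 1 (fun x => x + c) 1) := by
          refine (Metric.isBounded_closedBall (x := 0) (r := 1 + c)).subset ?_
          rintro _ ⟨z, ⟨⟨h0, h0'⟩, h1, h⟩, rfl⟩
          rw [mem_closedBall_zero_iff, pi_norm_le_iff_of_nonneg (by positivity)]
          intro i
          rw [Real.norm_eq_abs]
          refine Fin.cases ?_ (fun i => Fin.cases ?_ (fun j => ?_) i) i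
          · exact abs_le.2 ⟨by linarith, by linarith⟩
          · exact h1.trans (by linarith)
          · exact (h j).trans (by linarith)
        have := (PiLp.antilipschitzWith_ofLp 2 fun _ : Fin (n + 2) => ℝ).isBounded_preimage hb
        exact this.subset (Set.subset_preimage_image _ _)
     nonempty' := ⟨0, by simp [profileSet, hc.le]⟩ }, by
    let U : Set (EuclideanSpace ℝ (Fin (n + 2))) :=
      {z | z 0 ∈ Set.Ioo 0 1 ∧ |z 1| < c ∧ ∀ j : Fin n, |z j.succ.succ| < 1}
    have hU : IsOpen U := by
      have h : U = (fun z => z 0) ⁻¹' Set.Ioo 0 1 ∩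
          ({z | |z 1| < c} ∩ ⋂ j : Fin n, {z | |z j.succ.succ| < 1}) := by
        ext z
        simp [U]
      rw [h]
      exact (isOpen_Ioo.preimage (by fun_prop)).inter <|
        (isOpen_lt (by fun_prop) continuous_const).inter <|
          isOpen_iInter_of_finite fun j => isOpen_lt (by fun_prop) continuous_const
    refine ⟨EuclideanSpace.single 0 (1 / 2), interior_maximal ?_ hU ?_⟩
    · rintro z ⟨⟨h0, h0'⟩, h1, h⟩
      exact ⟨⟨h0.le, h0'.le⟩, h1.le.trans (by linarith), fun j => (h j).le⟩
    · refine ⟨?_, ?_, fun j => ?_⟩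
      · norm_num
      · simpa using hc
      · simp [Fin.succ_ne_zero]⟩

open FullConvexBody

theorem coe_trapezoidPrism (n : ℕ) {c : ℝ} (hc : 0 < c) :
    ((trapezoidPrism n hc).1 : Set (EuclideanSpace ℝ (Fin (n + 2))))
      = profileSet n 0 1 (fun x => x + c) 1 := rfl

/-- Half-widths of slices add up: over `x = 2s - t` the half-width is the maximum of `2(s + c) + (t
+ c)` for `s, t ∈ [0, 1]`. Since `2s + t = x + 2t = 4s - x`, the bounds are `2 + x` and `4 - x`, and
the smaller one is attained. -/
theorem coe_twoSub_trapezoidPrism (n : ℕ) {c : ℝ} (hc : 0 < c) :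
    ((twoSub (trapezoidPrism n hc)).1 : Set (EuclideanSpace ℝ (Fin (n + 2))))
      = profileSet n (-1) 2 (fun x => min (2 + x) (4 - x) + 3 * c) 3 := by
  ext z
  rw [mem_twoSub]
  constructor
  · rintro ⟨a, ⟨⟨ha0, ha0'⟩, ha1, ha⟩, b, ⟨⟨hb0, hb0'⟩, hb1, hb⟩, rfl⟩
    simp only [abs_le] at ha1 hb1 ha hb
    refine ⟨⟨?_, ?_⟩, ?_, fun j => abs_le.2 ⟨?_, ?_⟩⟩ <;>
    simp only [PiLp.sub_apply, PiLp.smul_apply, smul_eq_mul]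
    · linarith
    · linarith
    · rw [← sub_le_iff_le_add, le_min_iff, sub_le_iff_le_add, sub_le_iff_le_add]
      exact ⟨abs_le.2 ⟨by linarith, by linarith⟩, abs_le.2 ⟨by linarith, by linarith⟩⟩
    · linarith [(ha j).1, (hb j).2]
    · linarith [(ha j).2, (hb j).1]
  · rintro ⟨⟨h0, h0'⟩, h1, h⟩
    -- The maximum of `2s + t` is reached with `t = 1` when `z 0 ≤ 1`, and with `s = 1` otherwise.
    obtain ⟨s, t, hs, hs', ht, ht', hst, hR⟩ : ∃ s t : ℝ, 0 ≤ s ∧ s ≤ 1 ∧ 0 ≤ t ∧ t ≤ 1 ∧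
        2 * s - t = z 0 ∧ min (2 + z 0) (4 - z 0) = 2 * s + t := by
      rcases le_total (z 0) 1 with hz | hz
      · exact ⟨(1 + z 0) / 2, 1, by linarith, by linarith, by norm_num, le_rfl, by ring,
          by rw [min_eq_left (by linarith)]; ring⟩
      · exact ⟨1, 2 - z 0, by norm_num, le_rfl, by linarith, by linarith, by ring,
          by rw [min_eq_right (by linarith)]; ring⟩
    have hRpos : 0 < 2 * s + t + 3 * c := by positivity
    -- `q` is the relative height of `z` in its slice; the two chosen points take relative heights
    -- `q` and `-q`.
    set q := z 1 / (2 * s + t + 3 * c) with hq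
    have hq1 : |q| ≤ 1 := by
      rw [hq, abs_div, abs_of_pos hRpos, div_le_one hRpos, ← hR]
      exact h1
    have hqz : q * (2 * s + t + 3 * c) = z 1 := div_mul_cancel₀ _ hRpos.ne'
    have hbd : ∀ r, 0 ≤ r → |q * r| ≤ r := fun r hr => by
      rw [abs_mul, abs_of_nonneg hr]
      exact mul_le_of_le_one_left hr hq1
    refine ⟨WithLp.toLp 2 (Fin.cons s (Fin.cons (q * (s + c)) fun j => z j.succ.succ / 3)),
      ⟨⟨hs, hs'⟩, hbd _ (by positivity), fun j => ?_⟩,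
      WithLp.toLp 2 (Fin.cons t (Fin.cons (-(q * (t + c))) fun j => -(z j.succ.succ / 3))),
      ⟨⟨ht, ht'⟩, (abs_neg _).trans_le (hbd _ (by positivity)), fun j => ?_⟩, ?_⟩
    · have hj := abs_le.1 (h j)
      exact abs_le.2
        ⟨by simp only [Fin.cons_succ]; linarith, by simp only [Fin.cons_succ]; linarith⟩
    · have hj := abs_le.1 (h j)
      exact abs_le.2
        ⟨by simp only [Fin.cons_succ]; linarith, by simp only [Fin.cons_succ]; linarith⟩
    · ext i
      refine Fin.cases ?_ (fun i => Fin.cases ?_ (fun j => ?_) i) i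
      · exact hst
      · change 2 * (q * (s + c)) - -(q * (t + c)) = z 1
        rw [← hqz]
        ring
      · change 2 * (z j.succ.succ / 3) - -(z j.succ.succ / 3) = z j.succ.succ
        ring

theorem setIntegral_trapezoidPrism (n : ℕ) {c : ℝ} (hc : 0 < c) {f : ℝ → ℝ} (hf : Continuous f) :
    ∫ z in ((trapezoidPrism n hc).1 : Set (EuclideanSpace ℝ (Fin (n + 2)))), f (z 0)
      = 2 ^ n * ∫ x in (0 : ℝ)..1, f x * (2 * (x + c)) := by
  have h := (trapezoidPrism n hc).integrableOn
    (by fun_prop : Continuous fun z : EuclideanSpace ℝ (Fin (n + 2)) => f (z 0))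
  rw [coe_trapezoidPrism] at h ⊢
  rw [setIntegral_profileSet zero_le_one (by fun_prop) (fun x hx => by linarith [hx.1]) zero_le_one
    h, mul_one]

theorem setIntegral_twoSub_trapezoidPrism (n : ℕ) {c : ℝ} (hc : 0 < c) {f : ℝ → ℝ}
    (hf : Continuous f) :
    ∫ z in ((twoSub (trapezoidPrism n hc)).1 : Set (EuclideanSpace ℝ (Fin (n + 2)))), f (z 0)
      = 6 ^ n * ((∫ x in (-1 : ℝ)..1, f x * (2 * (2 + x + 3 * c)))
        + ∫ x in (1 : ℝ)..2, f x * (2 * (4 - x + 3 * c))) := by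
  have h := (twoSub (trapezoidPrism n hc)).integrableOn
    (by fun_prop : Continuous fun z : EuclideanSpace ℝ (Fin (n + 2)) => f (z 0))
  rw [coe_twoSub_trapezoidPrism] at h ⊢
  have hcont : Continuous fun x => f x * (2 * (min (2 + x) (4 - x) + 3 * c)) := by fun_prop
  rw [setIntegral_profileSet (by norm_num) (by fun_prop) (fun x hx => ?_) (by norm_num) h,
    ← intervalIntegral.integral_add_adjacent_intervals (b := 1) (hcont.intervalIntegrable _ _)
      (hcont.intervalIntegrable _ _)]
  · congr 1
    · norm_num
    · congr 1 <;> refine intervalIntegral.integral_congr fun x hx => ?_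
      · rw [Set.uIcc_of_le (by norm_num)] at hx
        rw [min_eq_left (by linarith [hx.2])]
      · rw [Set.uIcc_of_le (by norm_num)] at hx
        rw [min_eq_right (by linarith [hx.1])]
  · have : 0 ≤ min (2 + x) (4 - x) := le_min (by linarith [hx.1]) (by linarith [hx.2])
    linarith

/-! ### Explicit volumes and centroids of the test bodies. -/

theorem intervalIntegral_mul_linear (a b p q : ℝ) :
    ∫ x in a..b, x * (2 * (p * x + q))
      = 2 * (p * ((b ^ 3 - a ^ 3) / 3) + q * ((b ^ 2 - a ^ 2) / 2)) := by
  have h : ∀ x : ℝ, x * (2 * (p * x + q)) = 2 * (p * x ^ 2 + q * x) := fun x => by ring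
  simp only [h]
  rw [intervalIntegral.integral_const_mul, intervalIntegral.integral_add
    (Continuous.intervalIntegrable (by fun_prop) _ _)
    (Continuous.intervalIntegrable (by fun_prop) _ _), intervalIntegral.integral_const_mul,
    intervalIntegral.integral_const_mul, integral_pow, integral_id]
  norm_num

theorem intervalIntegral_linear (a b p q : ℝ) :
    ∫ x in a..b, 2 * (p * x + q) = 2 * (p * ((b ^ 2 - a ^ 2) / 2) + q * (b - a)) := by
  rw [intervalIntegral.integral_const_mul, intervalIntegral.integral_add
    (Continuous.intervalIntegrable (by fun_prop) _ _)
    (Continuous.intervalIntegrable (by fun_prop) _ _), intervalIntegral.integral_const_mul,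
    intervalIntegral.integral_const, integral_id, smul_eq_mul, mul_comm (b - a)]

theorem vol_trapezoidPrism (n : ℕ) {c : ℝ} (hc : 0 < c) :
    vol (trapezoidPrism n hc) = 2 ^ n * (1 + 2 * c) := by
  have h := setIntegral_trapezoidPrism n hc (f := fun _ => 1) continuous_const
  have h1 := intervalIntegral_linear 0 1 1 c
  simp only [one_mul] at h h1
  rw [vol_eq_integral, h, h1]
  ring

theorem vol_twoSub_trapezoidPrism (n : ℕ) {c : ℝ} (hc : 0 < c) :
    vol (twoSub (trapezoidPrism n hc)) = 6 ^ n * (13 + 18 * c) := by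
  have h := setIntegral_twoSub_trapezoidPrism n hc (f := fun _ => 1) continuous_const
  have h1 := intervalIntegral_linear (-1) 1 1 (2 + 3 * c)
  have h2 := intervalIntegral_linear 1 2 (-1) (4 + 3 * c)
  have e1 : ∀ x : ℝ, 2 + x + 3 * c = 1 * x + (2 + 3 * c) := fun x => by ring
  have e2 : ∀ x : ℝ, 4 - x + 3 * c = -1 * x + (4 + 3 * c) := fun x => by ring
  simp only [e1, e2, one_mul] at h h1
  rw [vol_eq_integral, h, h1, h2]
  ring

theorem centroid_apply {d : ℕ} (C : FullConvexBody d) (i : Fin d) :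
    centroid C i
      = (vol C)⁻¹ * ∫ z in (C.1 : Set (EuclideanSpace ℝ (Fin d))), z i := by
  rw [centroid, PiLp.smul_apply, smul_eq_mul]
  congr 1
  exact ((EuclideanSpace.proj i : EuclideanSpace ℝ (Fin d) →L[ℝ] ℝ).integral_comp_comm
    (C.integrableOn continuous_id)).symm

theorem centroid_trapezoidPrism (n : ℕ) {c : ℝ} (hc : 0 < c) :
    centroid (trapezoidPrism n hc) 0 = (2 + 3 * c) / (3 * (1 + 2 * c)) := by
  have h := setIntegral_trapezoidPrism n hc (f := fun x => x) continuous_id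
  have h1 := intervalIntegral_mul_linear 0 1 1 c
  simp only [one_mul] at h1
  rw [centroid_apply, h, h1, vol_trapezoidPrism]
  field_simp
  ring

theorem centroid_twoSub_trapezoidPrism (n : ℕ) {c : ℝ} (hc : 0 < c) :
    centroid (twoSub (trapezoidPrism n hc)) 0 = (26 + 27 * c) / (3 * (13 + 18 * c)) := by
  have h := setIntegral_twoSub_trapezoidPrism n hc (f := fun x => x) continuous_id
  have h1 := intervalIntegral_mul_linear (-1) 1 1 (2 + 3 * c)
  have h2 := intervalIntegral_mul_linear 1 2 (-1) (4 + 3 * c)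
  have e1 : ∀ x : ℝ, 2 + x + 3 * c = 1 * x + (2 + 3 * c) := fun x => by ring
  have e2 : ∀ x : ℝ, 4 - x + 3 * c = -1 * x + (4 + 3 * c) := fun x => by ring
  simp only [e1, e2] at h
  rw [centroid_apply, h, h1, h2, vol_twoSub_trapezoidPrism]
  field_simp
  ring

theorem theorem4p2 (d : ℕ) (hd : 2 ≤ d) :
    ¬ FiniteDimensional ℝ (affineInvariantPoints d).direction := by
  obtain ⟨n, rfl⟩ := Nat.exists_eq_add_of_le' hd
  let g : C(FullConvexBody (n + 2), EuclideanSpace ℝ (Fin (n + 2))) :=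
    ⟨centroid, continuous_centroid⟩
  let g' : C(FullConvexBody (n + 2), EuclideanSpace ℝ (Fin (n + 2))) :=
    ⟨fun C => centroid (twoSub C), continuous_centroid.comp continuous_twoSub⟩
  let φ : C(FullConvexBody (n + 2), ℝ) :=
    ⟨fun C => vol (twoSub C) / vol C,
      (continuous_vol.comp continuous_twoSub).div continuous_vol fun C => (vol_pos C).ne'⟩
  have hg : g ∈ affineInvariantPoints (n + 2) := fun T C => centroid_map T C
  have hg' : g' ∈ affineInvariantPoints (n + 2) := fun T C => by
    change centroid (twoSub (map T C)) = T (centroid (twoSub C))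
    rw [twoSub_map, centroid_map]
  refine not_finiteDimensional_direction_affineInvariantPoints (v := g' - g) (φ := φ)
    (AffineSubspace.vsub_mem_direction hg' hg) (fun T C => ?_) hg ?_
  · change vol (twoSub (map T C)) / vol (map T C) = vol (twoSub C) / vol C
    rw [twoSub_map, vol_map, vol_map, mul_div_mul_left _ _ (abs_det_linear_pos T).ne']
  · refine Set.infinite_of_injective_forall_mem
      (f := fun k : ℕ => φ (trapezoidPrism n (Nat.cast_add_one_pos (α := ℝ) k))) ?_ fun k => ?_
    · intro k l hkl
      have hk : (0 : ℝ) < k + 1 := Nat.cast_add_one_pos k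
      have hl : (0 : ℝ) < l + 1 := Nat.cast_add_one_pos l
      have h : vol (twoSub (trapezoidPrism n hk)) / vol (trapezoidPrism n hk)
          = vol (twoSub (trapezoidPrism n hl)) / vol (trapezoidPrism n hl) := hkl
      rw [vol_trapezoidPrism, vol_trapezoidPrism, vol_twoSub_trapezoidPrism,
        vol_twoSub_trapezoidPrism, mul_div_mul_comm, mul_div_mul_comm] at h
      -- With the factor `6 ^ n / 2 ^ n` removed, `(13 + 18c) / (1 + 2c) = 9 + 4 / (1 + 2c)`
      -- determines `c`.
      have h := mul_left_cancel₀ (by positivity) h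
      rw [div_eq_div_iff (by positivity) (by positivity)] at h
      exact_mod_cast (by linarith : (k : ℝ) = l)
    · refine ⟨_, fun h0 => ?_, rfl⟩
      have hk : (0 : ℝ) < k + 1 := Nat.cast_add_one_pos k
      have h : centroid (twoSub (trapezoidPrism n hk)) = centroid (trapezoidPrism n hk) :=
        sub_eq_zero.1 h0
      have h := congrArg (fun z : EuclideanSpace ℝ (Fin (n + 2)) => z 0) h
      simp only [centroid_trapezoidPrism, centroid_twoSub_trapezoidPrism] at h
      -- After cross-multiplication the two sides differ by `12c`, where `c = k + 1 > 0`.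
      rw [div_eq_div_iff (by positivity) (by positivity)] at h
      nlinarith
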